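/- The Genocchi numbers $G_n$ ($n\ge 0$) are defined by $$\sum_{n\ge 0} G_n\frac{t^n}{n!}=\frac{2t}{e^t+1},$$ and, for $k\in\mathbb Z$, the Arakawa–Kaneko $C$-poly-Bernoulli numbers $C_n^{(k)}$ ($n\ge 0$) by $$\sum_{n\ge 0} C_n^{(k)}\frac{t^n}{n!}=\frac{\mathrm{Li}_k(1-e^{-t})}{e^t-1},\qquad \mathrm{Li}_k(z)=\sum_{m\ge 1}\frac{z^m}{m^k}.$$ For $k,n\ge 0$, a Callan sequence of size $k\times n$ is a sequence of pairs $(B_1,R_1)\cdots(B_m,R_m)(B^*,R^*)$, for some $0\le m\le n$, such that $B_1,\dots,B_m,B^*$ are the $m+1$ distinct non-empty blocks of a set partition of $\{1,\dots,k\}\cup\{*\}$, $R_1,\dots,R_m,R^*$ are the $m+1$ distinct non-empty blocks of a set partition of $\{1,\dots,n\}\cup\{*\}$, and $*\in B^*$, $*\in R^*$. A barred Callan sequence of size $k\times n$ is obtained from a Callan sequence of size $k\times n$ by inserting one bar immediately before one of its $m+1$ pairs (so the bar is not at the end). Let $\mathcal C_n^k$ be the set of barred Callan sequences of size $k\times n$.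 **Theorem 3.1 (Kaneko–Sakurai–Tsumura identity).** For every $n\ge 0$, $$\sum_{j=0}^n (-1)^j\, C_{n-j}^{(-j-1)} = -G_{n+2},$$ and likewise, with $|\mathcal C_{n-j}^{j}|$ in place of $C_{n-j}^{(-j-1)}$, $$\sum_{j=0}^n (-1)^j\, |\mathcal C_{n-j}^{j}| = -G_{n+2}.$$ -/

import Mathlib

open scoped Nat

noncomputable section

namespace KST

open PowerSeries

/-- The Genocchi numbers: `∑ G_n t^n / n! = 2 t / (e^t + 1)` as formal power series.
The denominator has constant term `2`, so it is invertible in `ℚ⟦X⟧`. -/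
def genocchi (n : ℕ) : ℚ :=
  (n ! : ℚ) * coeff n (2 * X * (exp ℚ + 1)⁻¹)

/-- The polylogarithm `Li_k(z) = ∑_{m ≥ 1} z^m / m^k`, for any integer `k`,
as a formal power series. -/
def polylog (k : ℤ) : ℚ⟦X⟧ :=
  PowerSeries.mk fun m => if m = 0 then 0 else 1 / (m : ℚ) ^ k

/-- The formal power series `Li_k(1 - e^{-t})`. -/
def polylogExp (k : ℤ) : ℚ⟦X⟧ :=
  (polylog k).subst (1 - rescale (-1) (exp ℚ))

/-- The Arakawa–Kaneko numbers `C_n^{(k)}`: `∑ C_n^{(k)} t^n / n! = Li_k(1 - e^{-t}) / (e^t - 1)`.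
As `e^t - 1` has no constant term, the quotient is taken in the field of Laurent series; it has no
terms of negative degree, see `cPolyBernoulli_spec`. -/
def cPolyBernoulli (k : ℤ) (n : ℕ) : ℚ :=
  (n ! : ℚ) * HahnSeries.coeff
    ((polylogExp k : LaurentSeries ℚ) / ((exp ℚ - 1 : ℚ⟦X⟧) : LaurentSeries ℚ)) (n : ℤ)

/-- A Callan sequence `(B_1, R_1) ⋯ (B_m, R_m) (B^*, R^*)` of size `k × n`. The blue elements are
`Option (Fin k)` and the red ones `Option (Fin n)`, where `none` stands for `*`. The `m + 1` pairs
are indexed by `Fin (m + 1)`, the extra pair `(B^*, R^*)` being the last one. -/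
structure CallanSequence (k n : ℕ) where
  /-- the number of ordinary pairs -/
  m : ℕ
  m_le : m ≤ n
  blue : Fin (m + 1) → Finset (Option (Fin k))
  red : Fin (m + 1) → Finset (Option (Fin n))
  blue_nonempty : ∀ i, (blue i).Nonempty
  red_nonempty : ∀ i, (red i).Nonempty
  blue_partition : ∀ x, ∃! i, x ∈ blue i
  red_partition : ∀ x, ∃! i, x ∈ red i
  star_mem_blue : none ∈ blue (Fin.last m)
  star_mem_red : none ∈ red (Fin.last m)

/-- A barred Callan sequence: a Callan sequence with one bar inserted, not at the end; so the bar
stands immediately before one of the `m + 1` pairs, and `bar` is the index of that pair. -/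
structure BarredCallanSequence (k n : ℕ) extends CallanSequence k n where
  bar : Fin (m + 1)

/-- There are finitely many barred Callan sequences of a given size, so that `Nat.card` counts
them. -/
instance (k n : ℕ) : Finite (BarredCallanSequence k n) := by
  let T := Σ m : Fin (n + 1), (Fin (m.1 + 1) → Finset (Option (Fin k))) ×
    (Fin (m.1 + 1) → Finset (Option (Fin n))) × Fin (m.1 + 1)
  let f : BarredCallanSequence k n → T := fun s =>
    ⟨⟨s.m, Nat.lt_succ_of_le s.m_le⟩, s.blue, s.red, s.bar⟩
  refine Finite.of_injective f ?_
  rintro ⟨⟨m, _, b, r, _, _, _, _, _, _⟩, i⟩ ⟨⟨m', _, b', r', _, _, _, _, _, _⟩, i'⟩ h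
  have hm : m = m' := congrArg (fun t : T => t.1.1) h
  subst hm
  have h2 := eq_of_heq (Sigma.mk.inj h).2
  simp only [Prod.mk.injEq] at h2
  obtain ⟨rfl, rfl, rfl⟩ := h2
  rfl

theorem genocchi_spec :
    PowerSeries.mk (fun n => genocchi n / (n ! : ℚ)) * (exp ℚ + 1) = 2 * X := by
  have h : PowerSeries.mk (fun n => genocchi n / (n ! : ℚ)) = 2 * X * (exp ℚ + 1)⁻¹ := by
    ext n
    have : (n ! : ℚ) ≠ 0 := by positivity
    rw [coeff_mk, genocchi]
    field_simp
  rw [h, mul_assoc, PowerSeries.inv_mul_cancel _ (by norm_num), mul_one]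

theorem cPolyBernoulli_spec (k : ℤ) :
    PowerSeries.mk (fun n => cPolyBernoulli k n / (n ! : ℚ)) * (exp ℚ - 1) = polylogExp k := by
  have hL : constantCoeff (polylogExp k) = 0 :=
    constantCoeff_subst_eq_zero
      (by
        change constantCoeff (1 - rescale (-1) (exp ℚ)) = 0
        rw [← coeff_zero_eq_constantCoeff_apply]
        simp [coeff_rescale, coeff_exp, -coeff_zero_eq_constantCoeff])
      _ (by
        rw [← coeff_zero_eq_constantCoeff_apply]
        simp [polylog, -coeff_zero_eq_constantCoeff])
  obtain ⟨v, hv⟩ := X_dvd_iff.2 hL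
  obtain ⟨u, hu⟩ := X_dvd_iff.2 (show constantCoeff (exp ℚ - 1) = 0 by simp)
  have hu0 : constantCoeff u ≠ 0 := by
    have := congrArg (coeff 1) hu
    rw [show (1 : ℕ) = 0 + 1 from rfl, coeff_succ_X_mul, coeff_zero_eq_constantCoeff_apply] at this
    rw [← this]
    simp [coeff_exp, coeff_one]
  have hE : exp ℚ - 1 ≠ 0 := by
    intro h
    have := congrArg (coeff 1) h
    simp [coeff_exp, coeff_one] at this
  have hE' : ((exp ℚ - 1 : ℚ⟦X⟧) : LaurentSeries ℚ) ≠ 0 := by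
    intro h
    exact hE (HahnSeries.ofPowerSeries_injective (Γ := ℤ) (by rw [map_zero]; exact h))
  have hw : v * u⁻¹ * (exp ℚ - 1) = polylogExp k := by
    rw [hu, hv]
    linear_combination (X * v) * PowerSeries.inv_mul_cancel u hu0
  have hq : (polylogExp k : LaurentSeries ℚ) / ((exp ℚ - 1 : ℚ⟦X⟧) : LaurentSeries ℚ)
      = ((v * u⁻¹ : ℚ⟦X⟧) : LaurentSeries ℚ) := by
    rw [div_eq_iff hE', ← hw]
    exact map_mul (HahnSeries.ofPowerSeries ℤ ℚ) _ _
  rw [← hw]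
  congr 1
  ext n
  have : (n ! : ℚ) ≠ 0 := by positivity
  rw [coeff_mk, cPolyBernoulli, hq, HahnSeries.ofPowerSeries_apply_coeff]
  field_simp

end KST

end

/-! Write a_n(m) for `coverCount n m 1`, which equals m! S(n+1, m+1) with S a Stirling number of the
second kind. Both C_n^{(-k-1)} and the number of barred Callan sequences of size k × n equal ∑_m
(m+1) a_k(m) a_n(m): the first by applying (e^t - 1) d/dt repeatedly to Li_0(1 - e^{-t})
(`cPolyBernoulli_neg`), the second by choosing the two ordered partitions and the bar
(`card_barredCallanSequence`). It remains to show ∑_m (m+1) b_n(m) = -G_{n+2}, where b_n(m) = ∑_j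
(-1)^j a_j(m) a_{n-j}(m) (`sum_mul_altConv`). For odd n both sides vanish. For n = 2k, the b_{2k}(m)
are the coordinates of X^{2k+1} in the central factorial polynomials P_m = X ∏_{1≤i≤m} (1 - X²/i²)
(`X_pow_eq_sum_centralPoly`), and the umbral functional X^n ↦ G_n sends X P_m to -(m+1)
(`genocchiFunctional_X_mul_centralPoly`). -/

namespace KST

open scoped Nat

/-! ### Cover counts and their exponential generating functions -/

section PolylogExpansion

open PowerSeries

/-- The number of maps `Fin k → α`, `|α| = r + s`, whose range contains a given set of size `r`. -/
def coverCount : ℕ → ℕ → ℕ → ℕ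
  | 0, r, _ => if r = 0 then 1 else 0
  | k + 1, r, s => r * coverCount k (r - 1) (s + 1) + s * coverCount k r s

theorem derivative_expSubOne_pow_mul_exp_pow (r s : ℕ) :
    derivative ℚ ((exp ℚ - 1) ^ r * exp ℚ ^ s) =
      (r : ℚ⟦X⟧) * ((exp ℚ - 1) ^ (r - 1) * exp ℚ ^ (s + 1)) +
        (s : ℚ⟦X⟧) * ((exp ℚ - 1) ^ r * exp ℚ ^ s) := by
  rw [Derivation.leibniz, Derivation.leibniz_pow, Derivation.leibniz_pow, map_sub, derivative_exp,
    derivative_one]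
  simp only [smul_eq_mul, nsmul_eq_mul, sub_zero]
  rcases s with _ | s
  · simp
  · simp; ring

/-- Differentiation shifts exponential coefficients, so the derivative formula for (e^t - 1)^r
e^{st} is exactly the recursion defining `coverCount`. -/
theorem factorial_mul_coeff_expSubOne_pow_mul_exp_pow (k : ℕ) : ∀ r s : ℕ,
    (k ! : ℚ) * coeff k ((exp ℚ - 1) ^ r * exp ℚ ^ s) = coverCount k r s := by
  induction k with
  | zero =>
    intro r s
    by_cases hr : r = 0 <;> simp [coverCount, hr]
  | succ k ih =>
    intro r s
    have h := congrArg (coeff k) (derivative_expSubOne_pow_mul_exp_pow r s)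
    rw [coeff_derivative, map_add, ← nsmul_eq_mul, ← nsmul_eq_mul, map_nsmul, map_nsmul,
      nsmul_eq_mul, nsmul_eq_mul] at h
    rw [coverCount]
    push_cast [Nat.factorial_succ]
    rw [← ih, ← ih]
    linear_combination (k ! : ℚ) * h

theorem coverCount_eq_zero_of_lt {k r : ℕ} (s : ℕ) (h : k < r) : coverCount k r s = 0 := by
  induction k generalizing r s with
  | zero => simp [coverCount, h.ne']
  | succ k ih => rw [coverCount, ih _ (by omega), ih _ (by omega)]; simp

/-- The defining recursion leads from s = 1 to s = 2; writing one factor e^t as (e^t - 1) + 1 brings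
it back, so the recursion closes within s = 1. -/
theorem coverCount_succ_one (n m : ℕ) :
    coverCount (n + 1) m 1 = m * coverCount n (m - 1) 1 + (m + 1) * coverCount n m 1 := by
  have key : ((exp ℚ - 1) ^ (m - 1) * exp ℚ ^ 2) * (m : ℚ⟦X⟧) =
      ((exp ℚ - 1) ^ (m - 1) * exp ℚ ^ 1) * (m : ℚ⟦X⟧) +
      ((exp ℚ - 1) ^ m * exp ℚ ^ 1) * (m : ℚ⟦X⟧) := by
    rcases m with _ | m
    · simp
    · simp; ring
  have h := congrArg (fun f => (n ! : ℚ) * coeff n f) key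
  simp only [mul_comm _ (m : ℚ⟦X⟧), map_add, ← nsmul_eq_mul, map_nsmul] at h
  simp only [nsmul_eq_mul] at h
  have e1 := factorial_mul_coeff_expSubOne_pow_mul_exp_pow n (m - 1) 2
  have e2 := factorial_mul_coeff_expSubOne_pow_mul_exp_pow n (m - 1) 1
  have e3 := factorial_mul_coeff_expSubOne_pow_mul_exp_pow n m 1
  rw [coverCount]
  have : (m : ℚ) * coverCount n (m - 1) 2 =
      m * coverCount n (m - 1) 1 + m * coverCount n m 1 := by
    rw [← e1, ← e2, ← e3]
    linear_combination h
  have : m * coverCount n (m - 1) 2 =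
      m * coverCount n (m - 1) 1 + m * coverCount n m 1 := by exact_mod_cast this
  rw [this]; ring

/-! ### The polylogarithm side -/

theorem exp_mul_rescale_neg_one_exp : exp ℚ * rescale (-1) (exp ℚ) = 1 :=
  exp_mul_exp_neg_eq_one

theorem derivative_rescale_neg_one_exp :
    derivative ℚ (rescale (-1) (exp ℚ)) = -rescale (-1) (exp ℚ) := by
  ext n
  rw [coeff_derivative, map_neg, coeff_rescale, coeff_rescale, coeff_exp, coeff_exp]
  simp only [Nat.factorial_succ, pow_succ, Algebra.algebraMap_self, RingHom.id_apply]
  push_cast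
  field_simp

theorem hasSubst_one_sub_rescale_exp : HasSubst (1 - rescale (-1 : ℚ) (exp ℚ)) := by
  apply HasSubst.of_constantCoeff_zero'
  rw [← coeff_zero_eq_constantCoeff_apply]
  simp [coeff_rescale, coeff_exp, -coeff_zero_eq_constantCoeff]

theorem polylog_sub_one (k : ℤ) : polylog (k - 1) = X * derivative ℚ (polylog k) := by
  ext n
  rcases n with _ | n
  · simp [polylog]
  · rw [coeff_succ_X_mul, coeff_derivative, polylog, polylog, coeff_mk, coeff_mk]
    have h : ((n + 1 : ℕ) : ℚ) ≠ 0 := by positivity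
    rw [if_neg (by omega), if_neg (by omega), zpow_sub_one₀ h]
    push_cast at h ⊢
    field_simp

theorem one_sub_X_mul_polylog_zero : (1 - X) * polylog 0 = X := by
  rw [sub_mul, one_mul]
  ext n
  rcases n with _ | _ | n <;> simp [polylog, coeff_succ_X_mul, coeff_X]

theorem polylogExp_zero : polylogExp 0 = exp ℚ - 1 := by
  have h := congrArg (subst (1 - rescale (-1 : ℚ) (exp ℚ))) one_sub_X_mul_polylog_zero
  rw [subst_mul hasSubst_one_sub_rescale_exp, subst_sub hasSubst_one_sub_rescale_exp,
    subst_X hasSubst_one_sub_rescale_exp, ← coe_substAlgHom hasSubst_one_sub_rescale_exp,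
    map_one, coe_substAlgHom] at h
  change _ * polylogExp 0 = _ at h
  linear_combination exp ℚ * h - (polylogExp 0 + 1) * exp_mul_rescale_neg_one_exp

/-- For z = 1 - e^{-t} one has dz/dt = e^{-t}, so the operator z d/dz becomes (e^t - 1) d/dt. -/
theorem polylogExp_sub_one (k : ℤ) :
    polylogExp (k - 1) = (exp ℚ - 1) * derivative ℚ (polylogExp k) := by
  have hs := hasSubst_one_sub_rescale_exp
  rw [polylogExp, polylog_sub_one, subst_mul hs, subst_X hs, polylogExp, derivative_subst hs,
    map_sub, derivative_rescale_neg_one_exp, derivative_one]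
  linear_combination -(subst (1 - rescale (-1 : ℚ) (exp ℚ)) (derivative ℚ (polylog k))) *
    exp_mul_rescale_neg_one_exp

/-- Summation by parts moves the recursion for `coverCount` onto g. The boundary terms vanish
because a_k(k+1) = 0 and because of the factor m at m = 0. -/
theorem sum_range_mul_coverCount_succ (g : ℕ → ℚ⟦X⟧) (k : ℕ) :
    ∑ m ∈ Finset.range (k + 2), (coverCount (k + 1) m 1 : ℚ) • g m =
      ∑ m ∈ Finset.range (k + 1),
        (coverCount k m 1 : ℚ) • ((m + 1 : ℚ) • (g m + g (m + 1))) := by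
  simp only [coverCount_succ_one, Nat.cast_add, Nat.cast_mul, add_smul, smul_add,
    Finset.sum_add_distrib, Nat.cast_one]
  rw [add_comm]
  congr 1
  · rw [Finset.sum_range_succ, coverCount_eq_zero_of_lt _ (Nat.lt_succ_self k)]
    simp only [smul_smul]
    simp [mul_comm]
    simp only [mul_add, mul_one, add_smul, Finset.sum_add_distrib, mul_comm]
  · rw [Finset.sum_range_succ']
    simp only [smul_smul]
    simp [mul_comm]
    simp only [mul_add, mul_one, add_smul, Finset.sum_add_distrib, mul_comm]

/-- With g_m = (m+1)(e^t - 1)^{m+1} e^t, the operator (e^t - 1) d/dt sends g_m to (m+1)(g_m +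
g_{m+1}), the transpose of the recursion for a_k(m). -/
theorem polylogExp_neg (k : ℕ) : polylogExp (-(k : ℤ) - 1) =
    ∑ m ∈ Finset.range (k + 1), (coverCount k m 1 : ℚ) •
      ((m + 1 : ℚ) • ((exp ℚ - 1) ^ (m + 1) * exp ℚ)) := by
  induction k with
  | zero =>
    rw [Nat.cast_zero, neg_zero, polylogExp_sub_one, polylogExp_zero, map_sub, derivative_exp,
      derivative_one]
    simp [coverCount]
  | succ k ih =>
    rw [polylogExp_sub_one, show (-((k + 1 : ℕ) : ℤ)) = -(k : ℤ) - 1 by push_cast; ring, ih,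
      sum_range_mul_coverCount_succ, map_sum, Finset.mul_sum]
    refine Finset.sum_congr rfl fun m _ => ?_
    have := derivative_expSubOne_pow_mul_exp_pow (m + 1) 1
    rw [pow_one] at this
    rw [Derivation.map_smul, Derivation.map_smul, this, mul_smul_comm, mul_smul_comm]
    congr 2
    simp only [smul_eq_C_mul, map_add, map_natCast, map_one]
    push_cast
    ring_nf

theorem cPolyBernoulli_neg (k n : ℕ) : cPolyBernoulli (-(k : ℤ) - 1) n =
    ∑ m ∈ Finset.range (k + 1), (m + 1 : ℚ) * coverCount k m 1 * coverCount n m 1 := by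
  have hE : (exp ℚ - 1 : ℚ⟦X⟧) ≠ 0 := by
    intro h
    have := congrArg (coeff 1) h
    simp [coeff_exp, coeff_one] at this
  have h := cPolyBernoulli_spec (-(k : ℤ) - 1)
  have h2 : polylogExp (-(k : ℤ) - 1) = (∑ m ∈ Finset.range (k + 1), (coverCount k m 1 : ℚ) •
      ((m + 1 : ℚ) • ((exp ℚ - 1) ^ m * exp ℚ ^ 1))) * (exp ℚ - 1) := by
    rw [polylogExp_neg, Finset.sum_mul]
    refine Finset.sum_congr rfl fun m _ => ?_
    rw [smul_mul_assoc, smul_mul_assoc, pow_succ, pow_one]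
    congr 2
    ring
  have h3 := congrArg (fun f => (n ! : ℚ) * coeff n f) (mul_right_cancel₀ hE (h.trans h2))
  simp only [coeff_mk, map_sum, map_smul, smul_eq_mul, Finset.mul_sum] at h3
  rw [mul_div_cancel₀ _ (by positivity)] at h3
  rw [h3]
  refine Finset.sum_congr rfl fun m _ => ?_
  rw [← factorial_mul_coeff_expSubOne_pow_mul_exp_pow n]
  ring

end PolylogExpansion

/-! ### Counting barred Callan sequences -/

/-- The number of maps `Fin k → α` whose range contains `S`. -/
theorem card_subset_range {α : Type*} [Fintype α] [DecidableEq α] (k : ℕ) (S : Finset α) :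
    Nat.card {g : Fin k → α // ∀ x ∈ S, ∃ i, g i = x} =
      coverCount k S.card (Fintype.card α - S.card) := by
  induction k generalizing S with
  | zero =>
    rcases S.eq_empty_or_nonempty with rfl | ⟨x, hx⟩
    · simp [coverCount]
    · have : IsEmpty {g : Fin 0 → α // ∀ x ∈ S, ∃ i, g i = x} :=
        ⟨fun g => (g.2 x hx).choose.elim0⟩
      rw [Nat.card_of_isEmpty, coverCount, if_neg (Finset.card_ne_zero_of_mem hx)]
  | succ k ih =>
    -- Split off the value a at 0: the remaining map must still cover S without a. The cases a ∈ S
    -- and a ∉ S give the two terms of the recursion.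
    let e : {g : Fin (k + 1) → α // ∀ x ∈ S, ∃ i, g i = x} ≃
        Σ a : α, {g : Fin k → α // ∀ x ∈ S.erase a, ∃ i, g i = x} :=
      { toFun := fun g => ⟨g.1 0, fun i => g.1 i.succ, fun x hx => by
          obtain ⟨i, hi⟩ := g.2 x (Finset.mem_of_mem_erase hx)
          rcases Fin.eq_zero_or_eq_succ i with rfl | ⟨j, rfl⟩
          · exact absurd hi.symm (Finset.ne_of_mem_erase hx)
          · exact ⟨j, hi⟩⟩
        invFun := fun g => ⟨Fin.cons g.1 g.2.1, fun x hx => by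
          by_cases h : x = g.1
          · exact ⟨0, h.symm⟩
          · obtain ⟨i, hi⟩ := g.2.2 x (Finset.mem_erase.2 ⟨h, hx⟩)
            exact ⟨i.succ, hi⟩⟩
        left_inv := fun g => Subtype.ext (Fin.cons_self_tail g.1)
        right_inv := fun g => rfl }
    rw [Nat.card_congr e, Nat.card_sigma, ← Finset.sum_add_sum_compl S, coverCount]
    congr 1
    · rw [← smul_eq_mul]
      refine Finset.sum_eq_card_nsmul fun a ha => ?_
      have h1 := Finset.card_pos.2 ⟨a, ha⟩
      have h2 := Finset.card_le_univ S
      rw [ih, Finset.card_erase_of_mem ha]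
      congr 1
      omega
    · rw [← Finset.card_compl, ← smul_eq_mul]
      refine Finset.sum_eq_card_nsmul fun a ha => ?_
      rw [ih, Finset.erase_eq_of_notMem (Finset.mem_compl.1 ha), Finset.card_compl]

/-- Partitions of `Fin k ∪ {*}` into `m + 1` indexed non-empty blocks, `*` being in the last one. -/
def IndexedPartition (k m : ℕ) : Type :=
  {b : Fin (m + 1) → Finset (Option (Fin k)) //
    (∀ i, (b i).Nonempty) ∧ (∀ x, ∃! i, x ∈ b i) ∧ none ∈ b (Fin.last m)}

/-- A partition is the map taking each element to the index of its block. The last block is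
non-empty already, thanks to *, so only the other m indices must be hit. -/
theorem card_indexedPartition (k m : ℕ) :
    Nat.card (IndexedPartition k m) = coverCount k m 1 := by
  classical
  let S : Finset (Fin (m + 1)) := Finset.univ.erase (Fin.last m)
  let f : IndexedPartition k m → {g : Fin k → Fin (m + 1) // ∀ x ∈ S, ∃ i, g i = x} := fun b =>
    ⟨fun i => (b.2.2.1 (some i)).choose, fun x hx => by
      obtain ⟨y, hy⟩ := b.2.1 x
      rcases y with _ | i
      · exact absurd ((b.2.2.1 none).unique hy b.2.2.2) (Finset.ne_of_mem_erase hx)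
      · exact ⟨i, (b.2.2.1 (some i)).unique (b.2.2.1 (some i)).choose_spec.1 hy⟩⟩
  have mem_iff : ∀ (b : IndexedPartition k m) (i : Fin k) (j : Fin (m + 1)),
      some i ∈ b.1 j ↔ (f b).1 i = j := fun b i j =>
    ⟨fun h => (b.2.2.1 (some i)).unique (b.2.2.1 (some i)).choose_spec.1 h,
      fun h => h ▸ (b.2.2.1 (some i)).choose_spec.1⟩
  have mem_none : ∀ (b : IndexedPartition k m) (j : Fin (m + 1)),
      none ∈ b.1 j ↔ Fin.last m = j := fun b j =>
    ⟨fun h => (b.2.2.1 none).unique b.2.2.2 h, fun h => h ▸ b.2.2.2⟩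
  have hf : Function.Bijective f := by
    constructor
    · intro b c h
      refine Subtype.ext (funext fun j => Finset.ext fun x => ?_)
      rcases x with _ | i
      · rw [mem_none, mem_none]
      · rw [mem_iff, mem_iff, h]
    · intro g
      let G : Option (Fin k) → Fin (m + 1) := fun x => x.elim (Fin.last m) g.1
      let b : IndexedPartition k m := ⟨fun j => Finset.univ.filter fun x => G x = j, fun j => by
          by_cases hj : j = Fin.last m
          · exact ⟨none, by simp [G, hj]⟩
          · obtain ⟨i, hi⟩ := g.2 j (Finset.mem_erase.2 ⟨hj, Finset.mem_univ _⟩)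
            exact ⟨some i, by simp [G, hi]⟩,
        fun x => ⟨G x, by simp, fun j hj => (Finset.mem_filter.1 hj).2.symm⟩, by simp [G]⟩
      refine ⟨b, Subtype.ext (funext fun i => ?_)⟩
      rw [← mem_iff]
      simp [b, G]
  rw [Nat.card_eq_of_bijective f hf, card_subset_range]
  simp [S]

theorem card_barredCallanSequence (k n : ℕ) : Nat.card (BarredCallanSequence k n) =
    ∑ m ∈ Finset.range (n + 1), (m + 1) * coverCount k m 1 * coverCount n m 1 := by
  let e : BarredCallanSequence k n ≃
      Σ m : Fin (n + 1), IndexedPartition k m × IndexedPartition n m × Fin (m + 1) :=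
    { toFun := fun s => ⟨⟨s.m, Nat.lt_succ_of_le s.m_le⟩,
        ⟨s.blue, s.blue_nonempty, s.blue_partition, s.star_mem_blue⟩,
        ⟨s.red, s.red_nonempty, s.red_partition, s.star_mem_red⟩, s.bar⟩
      invFun := fun t =>
        { m := t.1
          m_le := Nat.le_of_lt_succ t.1.2
          blue := t.2.1.1
          red := t.2.2.1.1
          blue_nonempty := t.2.1.2.1
          red_nonempty := t.2.2.1.2.1
          blue_partition := t.2.1.2.2.1
          red_partition := t.2.2.1.2.2.1
          star_mem_blue := t.2.1.2.2.2
          star_mem_red := t.2.2.1.2.2.2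
          bar := t.2.2.2 }
      left_inv := fun _ => rfl
      right_inv := fun _ => rfl }
  have (k m : ℕ) : Finite (IndexedPartition k m) := by unfold IndexedPartition; infer_instance
  rw [Nat.card_congr e, Nat.card_sigma, Finset.sum_range]
  refine Finset.sum_congr rfl fun m _ => ?_
  rw [Nat.card_prod, Nat.card_prod, card_indexedPartition, card_indexedPartition,
    Nat.card_eq_fintype_card, Fintype.card_fin]
  ring

/-! ### Alternating convolutions and central factorial recurrence -/

section Convolution

open PowerSeries

/-- The ordinary generating function of `coverCount · m 1`. -/
def coverSeries (m : ℕ) : ℚ⟦X⟧ := PowerSeries.mk fun n => (coverCount n m 1 : ℚ)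

/-- This is the recursion in n read on ordinary generating functions; iterated, it gives m! x^m /
∏_{1≤i≤m+1} (1 - ix). -/
theorem coverSeries_mul (m : ℕ) :
    coverSeries m * (1 - C (m + 1 : ℚ) * X) =
      (if m = 0 then 1 else 0) + C (m : ℚ) * X * coverSeries (m - 1) := by
  rw [show coverSeries m * (1 - C (m + 1 : ℚ) * X) =
    coverSeries m - C (m + 1 : ℚ) * (X * coverSeries m) by ring, mul_assoc (C _)]
  ext n
  rcases n with _ | n
  · by_cases h : m = 0 <;> simp [h, coverSeries, coverCount]
  · rw [map_sub, coeff_C_mul, map_add, coeff_C_mul, coeff_succ_X_mul, coeff_succ_X_mul]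
    simp only [coverSeries, coeff_mk, coverCount_succ_one]
    have : coeff (n + 1) (if m = 0 then (1 : ℚ⟦X⟧) else 0) = 0 := by
      split_ifs <;> simp [coeff_one]
    rw [this]
    push_cast
    ring

/-- The alternating convolution of `coverCount · m 1` with itself. -/
def altConv (n m : ℕ) : ℚ :=
  ∑ j ∈ Finset.range (n + 1), (-1 : ℚ) ^ j * coverCount j m 1 * coverCount (n - j) m 1

theorem coeff_rescale_coverSeries_mul (n m : ℕ) :
    coeff n (rescale (-1) (coverSeries m) * coverSeries m) = altConv n m := by
  rw [coeff_mul, Finset.Nat.sum_antidiagonal_eq_sum_range_succ_mk, altConv]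
  simp [coverSeries, coeff_rescale]

/-- Multiplying the relation at x by the relation at -x pairs the factors 1 ± (m+1)x, leaving only
x². -/
theorem rescale_coverSeries_mul (m : ℕ) :
    rescale (-1) (coverSeries m) * coverSeries m * (1 - C ((m + 1 : ℚ) ^ 2) * X ^ 2) =
      (if m = 0 then 1 else 0) -
        C ((m : ℚ) ^ 2) * X ^ 2 * (rescale (-1) (coverSeries (m - 1)) * coverSeries (m - 1)) := by
  have h1 := coverSeries_mul m
  have h2 := congrArg (rescale (-1 : ℚ)) h1
  have hC (a : ℚ) : rescale (-1 : ℚ) (C a) = C a := by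
    ext n; rcases n with _ | n <;> simp [coeff_rescale, coeff_C]
  have h3 : (rescale (-1 : ℚ)) (if m = 0 then (1 : ℚ⟦X⟧) else 0) = if m = 0 then 1 else 0 := by
    split_ifs <;> simp
  simp only [map_mul, map_sub, map_add, map_one, hC, rescale_X, h3] at h2
  have h4 := congrArg₂ (· * ·) h2 h1
  simp only [map_neg, map_one, map_pow, map_add] at h4 ⊢
  -- The cross terms drop out: either the indicator of m = 0 or the factor m is zero.
  by_cases hm : m = 0
  · subst hm
    simp only [if_true, CharP.cast_eq_zero, map_zero] at h4 ⊢
    linear_combination h4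
  · simp only [if_neg hm] at h4 ⊢
    linear_combination h4

theorem altConv_zero (m : ℕ) : altConv 0 m = if m = 0 then 1 else 0 := by
  by_cases h : m = 0 <;> simp [altConv, coverCount, h]

theorem altConv_one (m : ℕ) : altConv 1 m = 0 := by
  simp [altConv, Finset.sum_range_succ]
  ring

theorem altConv_add_two (n m : ℕ) :
    altConv (n + 2) m = (m + 1) ^ 2 * altConv n m - m ^ 2 * altConv n (m - 1) := by
  have h := congrArg (coeff (n + 2)) (rescale_coverSeries_mul m)
  rw [mul_sub, mul_one, ← mul_assoc, mul_comm _ (C _), mul_assoc (C _), mul_assoc (C _), map_sub,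
    map_sub, coeff_C_mul, coeff_C_mul, mul_comm _ (X ^ 2), coeff_X_pow_mul, coeff_X_pow_mul,
    coeff_rescale_coverSeries_mul, coeff_rescale_coverSeries_mul,
    coeff_rescale_coverSeries_mul] at h
  have : coeff (n + 2) (if m = 0 then (1 : ℚ⟦X⟧) else 0) = 0 := by
    split_ifs <;> simp [coeff_one]
  rw [this] at h
  linear_combination h

theorem altConv_eq_zero_of_odd {n : ℕ} (hn : Odd n) (m : ℕ) : altConv n m = 0 := by
  obtain ⟨k, rfl⟩ := hn
  induction k generalizing m with
  | zero => exact altConv_one m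
  | succ k ih =>
    rw [show 2 * (k + 1) + 1 = 2 * k + 1 + 2 by ring, altConv_add_two, ih, ih]
    simp

theorem altConv_two_mul_eq_zero_of_lt {k m : ℕ} (h : k < m) : altConv (2 * k) m = 0 := by
  induction k generalizing m with
  | zero => rw [altConv_zero, if_neg h.ne']
  | succ k ih =>
    rw [show 2 * (k + 1) = 2 * k + 2 by ring, altConv_add_two, ih (by omega), ih (by omega)]
    simp

/-! ### Genocchi numbers -/

theorem sum_choose_mul_genocchi (n : ℕ) :
    ∑ k ∈ Finset.range (n + 1), (n.choose k : ℚ) * genocchi k + genocchi n =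
      if n = 1 then 2 else 0 := by
  have h := congrArg (fun f => (n ! : ℚ) * coeff n f) genocchi_spec
  rw [mul_add, mul_one, map_add, coeff_mul, Finset.Nat.sum_antidiagonal_eq_sum_range_succ_mk,
    coeff_mk, mul_add, mul_div_cancel₀ _ (by positivity), Finset.mul_sum,
    show (2 : ℚ⟦X⟧) * X = C (2 : ℚ) * X by rw [map_ofNat], coeff_C_mul, coeff_X] at h
  have h2 : ∑ k ∈ Finset.range (n + 1), (n.choose k : ℚ) * genocchi k =
      ∑ k ∈ Finset.range (n + 1), (n ! : ℚ) * (coeff k (PowerSeries.mk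
        fun n => genocchi n / (n ! : ℚ)) * coeff (n - k) (exp ℚ)) := by
    refine Finset.sum_congr rfl fun k hk => ?_
    rw [coeff_mk, coeff_exp, Nat.cast_choose ℚ (by grind)]
    simp
    field_simp
  rw [h2, h]
  by_cases hn : n = 1 <;> simp [hn]

theorem genocchi_eq_zero_of_odd {n : ℕ} (hn : Odd n) (h1 : n ≠ 1) : genocchi n = 0 := by
  set g : ℚ⟦X⟧ := PowerSeries.mk fun n => genocchi n / (n ! : ℚ) with hg
  have h := genocchi_spec
  rw [← hg] at h
  have h2 := congrArg (rescale (-1 : ℚ)) h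
  rw [map_mul, map_add, map_one, map_mul, map_ofNat, rescale_X] at h2
  have hne : (exp ℚ + 1 : ℚ⟦X⟧) ≠ 0 := by
    intro h
    have := congrArg (coeff 0) h
    norm_num [coeff_exp] at this
  -- Since 2t/(e^t + 1) + 2t/(e^{-t} + 1) = 2t, the odd part of the generating function is just t.
  have h3 : g - rescale (-1 : ℚ) g = C (2 : ℚ) * X := by
    apply mul_right_cancel₀ hne
    simp only [map_neg, map_one] at h2
    rw [map_ofNat]
    linear_combination h - exp ℚ * h2 + rescale (-1 : ℚ) g * exp_mul_rescale_neg_one_exp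
  have h4 := congrArg (coeff n) h3
  rw [map_sub, coeff_rescale, coeff_C_mul, coeff_X, if_neg h1, hn.neg_one_pow, hg, coeff_mk] at h4
  have : (n ! : ℚ) ≠ 0 := by positivity
  field_simp at h4
  linarith

end Convolution

/-! ### Umbral evaluation on central factorial polynomials -/

section Umbral

open Polynomial

/-- The linear functional on polynomials sending `X ^ n` to the `n`-th Genocchi number. -/
noncomputable def genocchiFunctional : ℚ[X] →ₗ[ℚ] ℚ := (basisMonomials ℚ).constr ℚ genocchi

theorem genocchiFunctional_X_pow (n : ℕ) : genocchiFunctional (X ^ n) = genocchi n := by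
  rw [X_pow_eq_monomial, genocchiFunctional]
  simpa using (basisMonomials ℚ).constr_basis ℚ genocchi n

/-- Umbral form of the defining equation G(t)(e^t + 1) = 2t: multiplication by e^t is the shift X ↦
X + 1. -/
theorem genocchiFunctional_comp_add (p : ℚ[X]) :
    genocchiFunctional (p.comp (X + 1)) + genocchiFunctional p = 2 * p.derivative.eval 0 := by
  induction p using Polynomial.induction_on' with
  | add p q hp hq =>
    simp only [add_comp, map_add, eval_add]
    linear_combination hp + hq
  | monomial n a =>
    have h := sum_choose_mul_genocchi n
    have e1 : genocchiFunctional ((X + 1) ^ n) =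
        ∑ k ∈ Finset.range (n + 1), (n.choose k : ℚ) * genocchi k := by
      rw [add_pow, map_sum]
      refine Finset.sum_congr rfl fun k _ => ?_
      rw [one_pow, mul_one, mul_comm, ← nsmul_eq_mul, map_nsmul, genocchiFunctional_X_pow,
        nsmul_eq_mul]
    rw [monomial_comp, ← C_mul_X_pow_eq_monomial, ← smul_eq_C_mul, ← smul_eq_C_mul, map_smul,
      map_smul, e1, genocchiFunctional_X_pow, smul_eq_mul, smul_eq_mul, ← mul_add, h]
    rcases n with _ | _ | n <;> simp; ring

/-- The central factorial polynomial `X ∏ (1 - X² / i²)`, the product being over `1 ≤ i ≤ m`. -/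
noncomputable def centralPoly : ℕ → ℚ[X]
  | 0 => X
  | m + 1 => centralPoly m * (1 - C (((m : ℚ) + 1) ^ 2)⁻¹ * X ^ 2)

/-- The roots are the integers from -m to m; the shift trades the root m for -m-1. -/
theorem centralPoly_comp_add (m : ℕ) :
    (centralPoly m).comp (X + 1) * (X - C (m : ℚ)) = (X + C (m + 1 : ℚ)) * centralPoly m := by
  induction m with
  | zero => simp [centralPoly, mul_comm]
  | succ m ih =>
    have hc : C (((m : ℚ) + 1) ^ 2)⁻¹ * (C (m : ℚ) + 1) ^ 2 = 1 := by
      rw [show C (m : ℚ) + 1 = C ((m : ℚ) + 1) by simp, ← map_pow, ← map_mul,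
        inv_mul_cancel₀ (by positivity), map_one]
    simp only [centralPoly, mul_comp, sub_comp, one_comp, C_comp, pow_comp, X_comp]
    push_cast
    simp only [map_add, map_one] at ih ⊢
    generalize C (((m : ℚ) + 1) ^ 2)⁻¹ = c at *
    generalize C (m : ℚ) = M at *
    have h1 : (1 : ℚ[X]) - c * (X + 1) ^ 2 = -(c * ((X - M) * (X + M + 2))) := by
      linear_combination -hc
    have h2 : (1 : ℚ[X]) - c * X ^ 2 = -(c * ((X - M - 1) * (X + M + 1))) := by
      linear_combination -hc
    rw [h1, h2]
    linear_combination -(c * (X + M + 2) * (X - M - 1)) * ih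

theorem eval_centralPoly (m : ℕ) : (centralPoly m).eval 0 = 0 := by
  induction m with
  | zero => simp [centralPoly]
  | succ m ih => simp [centralPoly, ih]

theorem eval_derivative_centralPoly (m : ℕ) : (centralPoly m).derivative.eval 0 = 1 := by
  induction m with
  | zero => simp [centralPoly]
  | succ m ih => simp [centralPoly, ih]

/-- For p = P_m · (X - m - 1), the shift relation turns p(X+1) into (X + m + 1) P_m, so p(X+1) +
p(X) = 2X P_m, while p'(0) = -(m+1). -/
theorem genocchiFunctional_X_mul_centralPoly (m : ℕ) :
    genocchiFunctional (X * centralPoly m) = -(m + 1) := by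
  have h := genocchiFunctional_comp_add (centralPoly m * (X - C (m + 1 : ℚ)))
  have e : (centralPoly m * (X - C (m + 1 : ℚ))).comp (X + 1) +
      centralPoly m * (X - C (m + 1 : ℚ)) = (2 : ℚ) • (X * centralPoly m) := by
    have := centralPoly_comp_add m
    simp only [mul_comp, sub_comp, X_comp, C_comp]
    simp only [map_add, map_one, smul_eq_C_mul, map_ofNat] at this ⊢
    linear_combination this
  rw [← map_add, e, map_smul] at h
  simp [eval_centralPoly, eval_derivative_centralPoly] at h
  linarith

theorem X_sq_mul_centralPoly (m : ℕ) :
    X ^ 2 * centralPoly m = ((m : ℚ) + 1) ^ 2 • (centralPoly m - centralPoly (m + 1)) := by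
  have hc : C (((m : ℚ) + 1) ^ 2) * C (((m : ℚ) + 1) ^ 2)⁻¹ = 1 := by
    rw [← map_mul, mul_inv_cancel₀ (by positivity), map_one]
  rw [centralPoly, smul_eq_C_mul]
  linear_combination -(X ^ 2 * centralPoly m) * hc

/-- Multiplication by X² sends P_m to (m+1)² (P_m - P_{m+1}), which on coordinates is the recurrence
`altConv_add_two`. -/
theorem X_pow_eq_sum_centralPoly (k : ℕ) : (X : ℚ[X]) ^ (2 * k + 1) =
    ∑ m ∈ Finset.range (k + 1), altConv (2 * k) m • centralPoly m := by
  induction k with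
  | zero => simp [altConv_zero, centralPoly]
  | succ k ih =>
    rw [show 2 * (k + 1) + 1 = 2 + (2 * k + 1) by ring, pow_add, ih, Finset.mul_sum,
      show 2 * (k + 1) = 2 * k + 2 by ring]
    simp only [altConv_add_two, sub_smul, Finset.sum_sub_distrib, mul_smul_comm,
      X_sq_mul_centralPoly, smul_sub]
    congr 1
    · rw [Finset.sum_range_succ _ (k + 1), altConv_two_mul_eq_zero_of_lt (Nat.lt_succ_self k)]
      simp [smul_smul, mul_comm]
    · rw [Finset.sum_range_succ' _ (k + 1)]
      simp [smul_smul, mul_comm]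

theorem sum_mul_altConv (n : ℕ) :
    ∑ m ∈ Finset.range (n + 1), (m + 1 : ℚ) * altConv n m = -genocchi (n + 2) := by
  rcases Nat.even_or_odd n with ⟨k, rfl⟩ | hn
  · rw [← two_mul]
    have h := congrArg (fun p => genocchiFunctional (X * p)) (X_pow_eq_sum_centralPoly k)
    simp only [← pow_succ', genocchiFunctional_X_pow, Finset.mul_sum, map_sum, mul_smul_comm,
      map_smul, genocchiFunctional_X_mul_centralPoly, smul_eq_mul] at h
    rw [show 2 * k + 2 = 2 * k + 1 + 1 from rfl, h, ← Finset.sum_neg_distrib]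
    symm
    -- The expansion stops at m = k, whereas the sum runs to 2k; the terms in between vanish.
    refine Finset.sum_subset_zero_on_sdiff (Finset.range_mono (by omega)) (fun m hm => ?_)
      fun m _ => by ring
    rw [altConv_two_mul_eq_zero_of_lt (by grind), mul_zero]
  · rw [genocchi_eq_zero_of_odd (by grind) (by omega), neg_zero]
    exact Finset.sum_eq_zero fun m _ => by rw [altConv_eq_zero_of_odd hn, mul_zero]

end Umbral

/-! ### Assembling the two identities -/

/-- Serves both identities at once. The range n + 1, independent of k and l, lets the sums over j
and m be exchanged; the added terms vanish since a_k(m) = 0 for m > k. -/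
theorem sum_neg_one_pow_mul_eq_neg_genocchi (n : ℕ) (c : ℕ → ℕ → ℚ)
    (hc : ∀ k l, k + l = n → c k l = ∑ m ∈ Finset.range (n + 1),
      (m + 1 : ℚ) * coverCount k m 1 * coverCount l m 1) :
    ∑ j ∈ Finset.range (n + 1), (-1 : ℚ) ^ j * c j (n - j) = -genocchi (n + 2) := by
  rw [← sum_mul_altConv]
  simp only [altConv, Finset.mul_sum]
  rw [Finset.sum_comm]
  refine Finset.sum_congr rfl fun j hj => ?_
  rw [hc _ _ (by grind), Finset.mul_sum]
  exact Finset.sum_congr rfl fun m _ => by ring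

end KST

theorem theorem3p1 (n : ℕ) :
    (∑ j ∈ Finset.range (n + 1),
        (-1 : ℚ) ^ j * KST.cPolyBernoulli (-(j : ℤ) - 1) (n - j) = -KST.genocchi (n + 2)) ∧
    (∑ j ∈ Finset.range (n + 1),
        (-1 : ℚ) ^ j * (Nat.card (KST.BarredCallanSequence j (n - j)) : ℚ)
          = -KST.genocchi (n + 2)) := by
  constructor
  · refine KST.sum_neg_one_pow_mul_eq_neg_genocchi n
      (fun k l => KST.cPolyBernoulli (-(k : ℤ) - 1) l) fun k l h => ?_
    rw [KST.cPolyBernoulli_neg]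
    refine Finset.sum_subset (Finset.range_mono (by omega)) fun m _ hm => ?_
    rw [KST.coverCount_eq_zero_of_lt 1 (show k < m by grind)]
    simp
  · refine KST.sum_neg_one_pow_mul_eq_neg_genocchi n
      (fun k l => (Nat.card (KST.BarredCallanSequence k l) : ℚ)) fun k l h => ?_
    rw [KST.card_barredCallanSequence]
    push_cast
    refine Finset.sum_subset (Finset.range_mono (by omega)) fun m _ hm => ?_
    rw [KST.coverCount_eq_zero_of_lt 1 (show l < m by grind)]
    simp
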